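/- A rooted forest on $[n]=\{1,\dots,n\}$ is an unordered (non-planar) forest on $n$ vertices, labeled bijectively by $[n]$, in which every connected component has a distinguished root. A pattern of length $k$ is a permutation $\pi=\pi(1)\cdots\pi(k)$ of $[k]$. A rooted forest consecutively contains $\pi$ if it has vertices $v_1,\dots,v_k$ such that $v_i$ is the parent of $v_{i+1}$ for all $1\le i<k$ and the labels of $v_1,\dots,v_k$ are in the same relative order as $\pi(1),\dots,\pi(k)$; otherwise it consecutively avoids $\pi$. Two patterns $\pi,\pi'$ are c-forest-Wilf equivalent if for every $N\ge 0$ the number of rooted forests on $[N]$ consecutively avoiding $\pi$ equals the number of rooted forests on $[N]$ consecutively avoiding $\pi'$. Theorem. For every $n$ there is a c-forest-Wilf equivalence class (of patterns) that contains at least $2^{n-4}$ patterns of length $n$. -/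

import Mathlib

/-- An unordered rooted forest with vertex set `V`: every vertex has at most one parent
(roots have none), and there is no infinite ascending chain of parents (for finite `V`: no cycle).
A vertex is identified with its label, so `RootedForest (Fin n)` is the type of rooted
labeled forests on `n` labels, the labels `1, …, n` being written `0, …, n - 1`. -/
@[ext]
structure RootedForest (V : Type*) where
  parent : V → Option V
  acyclic : WellFounded fun u v : V => parent v = some u

instance RootedForest.instFinite {V : Type*} [Finite V] : Finite (RootedForest V) :=
  Finite.of_injective RootedForest.parent fun _ _ h => RootedForest.ext h

/-- A pattern: a permutation of `{0, …, length - 1}` (in place of `{1, …, length}`). -/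
structure Pattern where
  length : ℕ
  perm : Equiv.Perm (Fin length)

namespace RootedForest

variable {V : Type*} [LinearOrder V]

/-- `v 0, v 1, …` is a downward path of `F`, each vertex being the parent of the next one, whose
labels are in the same relative order as `π`. -/
def IsConsecutiveInstance (F : RootedForest V) (π : Pattern) (v : Fin π.length → V) : Prop :=
  (∀ i j : Fin π.length, (i : ℕ) + 1 = (j : ℕ) → F.parent (v j) = some (v i)) ∧
    ∀ i j : Fin π.length, v i < v j ↔ π.perm i < π.perm j

def ConsecutivelyContains (F : RootedForest V) (π : Pattern) : Prop :=
  ∃ v : Fin π.length → V, F.IsConsecutiveInstance π v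

def ConsecutivelyAvoids (F : RootedForest V) (S : Set Pattern) : Prop :=
  ∀ π ∈ S, ¬ F.ConsecutivelyContains π

end RootedForest

/-- The number of rooted labeled forests on `n` labels that consecutively avoid `S`. -/
noncomputable def numConsecutivelyAvoiding (S : Set Pattern) (n : ℕ) : ℕ :=
  Nat.card {F : RootedForest (Fin n) // F.ConsecutivelyAvoids S}

def CForestWilfEquivalent (S S' : Set Pattern) : Prop :=
  ∀ n : ℕ, numConsecutivelyAvoiding S n = numConsecutivelyAvoiding S' n

/-- c-forest-Wilf equivalence of single patterns. -/
def cForestWilfSetoid : Setoid Pattern where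
  r π π' := CForestWilfEquivalent {π} {π'}
  iseqv := ⟨fun _ _ => rfl, fun h n => (h n).symm, fun h h' n => (h n).trans (h' n)⟩

/-! Positions are counted from 0. In a zigzag pattern the letters at positions 0, 1, 2 ascend, and
every later pair of consecutive letters alternates between descent and ascent around the letter at
position 2. So a double ascent occurs only at the start, and two occurrences in a forest that share
a vertex at position at least 2 in both share it at the same position
(`IsConsecutiveInstance.position_eq`).

By inclusion-exclusion, the avoiding forests are counted by pairs of a forest and a set of marked
occurrences, with sign (`card_consecutivelyAvoids_eq_sum`). A flip of the pattern at `t` lifts to a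
bijection of such pairs that preserves the number of marks: group the vertices at positions `t, t +
2, …` of the marked occurrences by their common vertex at position `t - 1`, reverse the order of the
labels within each group, and rewire the parents of the tail vertices accordingly (`Marked.flip`,
`Marked.flip_flip`). Hence patterns related by a flip are equivalent.

For each position from 3 to `n - 3` a bit decides whether its letter is below or above the later
letters of the same parity. Flipping at `t` and then at `t + 2` changes the bit at `t` alone, so all
`2 ^ (n - 5)` choices are equivalent; complementation doubles the family. -/

open Finset

/-! ### Order reversal inside disjoint blocks -/

section BlockReverse

variable {V : Type*} [LinearOrder V]

/-- The order-reversing involution of a finite set `A`, extended by the identity. -/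
noncomputable def Finset.orderReverse (A : Finset V) (x : V) : V :=
  if h : x ∈ A then A.orderIsoOfFin rfl ((A.orderIsoOfFin rfl).symm ⟨x, h⟩).rev else x

theorem Finset.orderReverse_mem {A : Finset V} {x : V} (h : x ∈ A) : A.orderReverse x ∈ A := by
  simp only [Finset.orderReverse, h, dif_pos]
  exact Subtype.coe_prop _

theorem Finset.orderReverse_orderReverse {A : Finset V} {x : V} (h : x ∈ A) :
    A.orderReverse (A.orderReverse x) = x := by
  have h' := orderReverse_mem h
  rw [Finset.orderReverse, dif_pos h']
  have : (⟨A.orderReverse x, h'⟩ : A) =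
      A.orderIsoOfFin rfl ((A.orderIsoOfFin rfl).symm ⟨x, h⟩).rev :=
    Subtype.ext (by simp [Finset.orderReverse, h])
  simp [this]

theorem Finset.orderReverse_lt_iff {A : Finset V} {x y : V} (hx : x ∈ A) (hy : y ∈ A) :
    A.orderReverse x < A.orderReverse y ↔ y < x := by
  simp only [Finset.orderReverse, hx, hy, dif_pos, Subtype.coe_lt_coe, OrderIso.lt_iff_lt,
    Fin.rev_lt_rev]
  exact Subtype.mk_lt_mk

open Classical in
/-- Reverses the order inside each block `G q` of a family of disjoint finite sets. -/
noncomputable def blockReverse {ι : Type*} (G : ι → Finset V) (x : V) : V :=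
  if h : ∃ q, x ∈ G q then (G h.choose).orderReverse x else x

variable {ι : Type*} {G : ι → Finset V}

theorem blockReverse_of_mem (hG : ∀ q q' x, x ∈ G q → x ∈ G q' → q = q') {q : ι} {x : V}
    (h : x ∈ G q) : blockReverse G x = (G q).orderReverse x := by
  have h' : ∃ q, x ∈ G q := ⟨q, h⟩
  rw [blockReverse, dif_pos h', hG _ _ _ h'.choose_spec h]

theorem blockReverse_of_notMem {x : V} (h : ∀ q, x ∉ G q) : blockReverse G x = x := by
  rw [blockReverse, dif_neg (by simpa using h)]

theorem blockReverse_mem (hG : ∀ q q' x, x ∈ G q → x ∈ G q' → q = q') {q : ι} {x : V}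
    (h : x ∈ G q) : blockReverse G x ∈ G q := by
  rw [blockReverse_of_mem hG h]
  exact orderReverse_mem h

theorem blockReverse_involutive (hG : ∀ q q' x, x ∈ G q → x ∈ G q' → q = q') :
    Function.Involutive (blockReverse G) := by
  intro x
  by_cases h : ∃ q, x ∈ G q
  · obtain ⟨q, hq⟩ := h
    rw [blockReverse_of_mem hG (blockReverse_mem hG hq), blockReverse_of_mem hG hq,
      orderReverse_orderReverse hq]
  · push Not at h
    simp [blockReverse_of_notMem h]

theorem blockReverse_lt_iff (hG : ∀ q q' x, x ∈ G q → x ∈ G q' → q = q') {q : ι} {x y : V}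
    (hx : x ∈ G q) (hy : y ∈ G q) : blockReverse G x < blockReverse G y ↔ y < x := by
  rw [blockReverse_of_mem hG hx, blockReverse_of_mem hG hy, orderReverse_lt_iff hx hy]

end BlockReverse

/-! ### Zigzag patterns and flips -/

section Zigzag

variable {n : ℕ}

/-- The first letter is the least one, the second letter the second least one, and from the fourth
letter on the pattern is alternately below and above its third letter. -/
structure IsZigzag (π : Equiv.Perm (Fin n)) : Prop where
  zero_lt : ∀ i j : Fin n, (i : ℕ) = 0 → 0 < (j : ℕ) → π i < π j
  one_lt : ∀ i j : Fin n, (i : ℕ) = 1 → 1 < (j : ℕ) → π i < π j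
  lt_two : ∀ i j : Fin n, (i : ℕ) = 2 → 2 < (j : ℕ) → (j : ℕ) % 2 = 1 → π j < π i
  two_lt : ∀ i j : Fin n, (i : ℕ) = 2 → 2 < (j : ℕ) → (j : ℕ) % 2 = 0 → π i < π j

/-- The positions `t, t + 2, t + 4, …`. -/
def InTail (t : ℕ) (i : Fin n) : Prop := t ≤ (i : ℕ) ∧ (i : ℕ) % 2 = t % 2

/-- `π'` arises from `π` by reversing the order of the letters at positions `t, t + 2, …`, which
occupy an interval of values. -/
structure IsFlip (t : ℕ) (π π' : Equiv.Perm (Fin n)) : Prop where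
  three_le : 3 ≤ t
  reverse : ∀ i j, InTail t i → InTail t j → (π' i < π' j ↔ π j < π i)
  same : ∀ i j, ¬ (InTail t i ∧ InTail t j) → (π' i < π' j ↔ π i < π j)
  convex : ∀ i j k, InTail t i → InTail t j → ¬ InTail t k → (π i < π k ↔ π j < π k)

variable {t : ℕ} {π π' : Equiv.Perm (Fin n)}

theorem IsFlip.symm (h : IsFlip t π π') : IsFlip t π' π where
  three_le := h.three_le
  reverse i j hi hj := (h.reverse j i hj hi).symm
  same i j hij := (h.same i j hij).symm
  convex i j k hi hj hk := by
    rw [h.same i k (fun H => hk H.2), h.same j k (fun H => hk H.2)]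
    exact h.convex i j k hi hj hk

/-- Since `3 ≤ t`, no comparison with one of the first three letters is reversed. -/
theorem IsZigzag.of_isFlip (hπ : IsZigzag π) (h : IsFlip t π π') : IsZigzag π' := by
  have h3 := h.three_le
  constructor <;> intro i j hi hj
  · rw [h.same i j (fun H => by have := H.1.1; omega)]
    exact hπ.zero_lt i j hi hj
  · rw [h.same i j (fun H => by have := H.1.1; omega)]
    exact hπ.one_lt i j hi hj
  · rw [h.same j i (fun H => by have := H.2.1; omega)]
    exact hπ.lt_two i j hi hj
  · rw [h.same i j (fun H => by have := H.1.1; omega)]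
    exact hπ.two_lt i j hi hj

theorem IsZigzag.lt_succ (hπ : IsZigzag π) {i j : Fin n} (h : (i : ℕ) + 1 = j) (hj : 3 ≤ (j : ℕ))
    (hpar : (j : ℕ) % 2 = 0) : π i < π j := by
  have hn := j.2
  exact (hπ.lt_two ⟨2, by omega⟩ i rfl (by omega) (by omega)).trans
    (hπ.two_lt ⟨2, by omega⟩ j rfl (by omega) hpar)

theorem IsZigzag.succ_lt (hπ : IsZigzag π) {i j : Fin n} (h : (i : ℕ) + 1 = j) (hj : 3 ≤ (j : ℕ))
    (hpar : (j : ℕ) % 2 = 1) : π j < π i := by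
  have hn := j.2
  refine (hπ.lt_two ⟨2, by omega⟩ j rfl (by omega) hpar).trans_le ?_
  rcases eq_or_lt_of_le (show 2 ≤ (i : ℕ) by omega) with h2 | h2
  · exact le_of_eq (congrArg π (Fin.ext h2))
  · exact (hπ.two_lt ⟨2, by omega⟩ i rfl h2 (by omega)).le

end Zigzag

/-! ### Overlaps of occurrences -/

namespace RootedForest

variable {V : Type*} [LinearOrder V] {n : ℕ} {F : RootedForest V}

theorem IsConsecutiveInstance.parent_eq {π : Equiv.Perm (Fin n)} {v : Fin n → V}
    (hv : F.IsConsecutiveInstance ⟨n, π⟩ v) {i j : Fin n} (h : (i : ℕ) + 1 = j) :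
    F.parent (v j) = some (v i) :=
  hv.1 i j h

theorem IsConsecutiveInstance.lt_iff {π : Equiv.Perm (Fin n)} {v : Fin n → V}
    (hv : F.IsConsecutiveInstance ⟨n, π⟩ v) {i j : Fin n} : v i < v j ↔ π i < π j :=
  hv.2 i j

/-- Two occurrences of patterns with a common vertex agree on the way up from it. -/
theorem IsConsecutiveInstance.eq_of_eq {π π' : Equiv.Perm (Fin n)} {v v' : Fin n → V}
    (hv : F.IsConsecutiveInstance ⟨n, π⟩ v) (hv' : F.IsConsecutiveInstance ⟨n, π'⟩ v') (d : ℕ) :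
    ∀ i i' j j' : Fin n, (i : ℕ) + d = j → (i' : ℕ) + d = j' → v j = v' j' → v i = v' i' := by
  induction d with
  | zero =>
    intro i i' j j' h h' e
    obtain rfl : i = j := Fin.ext (by omega)
    obtain rfl : i' = j' := Fin.ext (by omega)
    exact e
  | succ d ih =>
    intro i i' j j' h h' e
    have hj := hv.parent_eq (i := ⟨i + d, by omega⟩) (j := j) (by simp; omega)
    have hj' := hv'.parent_eq (i := ⟨i' + d, by omega⟩) (j := j') (by simp; omega)
    rw [e, hj'] at hj
    exact ih i i' _ _ rfl rfl (Option.some_injective _ hj).symm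

/-- In two occurrences of a zigzag pattern, a common vertex has the same position, unless it is
among the first two vertices of one of them. -/
theorem IsConsecutiveInstance.position_eq {π : Equiv.Perm (Fin n)} (hπ : IsZigzag π)
    {v v' : Fin n → V} (hv : F.IsConsecutiveInstance ⟨n, π⟩ v)
    (hv' : F.IsConsecutiveInstance ⟨n, π⟩ v') {j j' : Fin n} (hj : 2 ≤ (j : ℕ))
    (hj' : 2 ≤ (j' : ℕ)) (h : v j = v' j') : j = j' := by
  wlog hlt : (j : ℕ) ≤ j' generalizing v v' j j'
  · exact (this hv' hv hj' hj h.symm (by omega)).symm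
  by_contra hne
  replace hlt : (j : ℕ) < j' := lt_of_le_of_ne hlt (fun e => hne (Fin.ext e))
  -- Position `m ≥ 3` of `v'` faces position 2 of `v`. The double ascent that starts `v` would then
  -- end at `m` in `v'`, but one of the steps into `m - 1` and `m`, the one into an odd position, is
  -- a descent.
  obtain ⟨m, hm⟩ : ∃ m : ℕ, m + j = j' + 2 := ⟨j' + 2 - j, by omega⟩
  have hn : (j' : ℕ) < n := j'.2
  have key : ∀ k : ℕ, ∀ h2 : k ≤ 2, v ⟨k, by omega⟩ = v' ⟨m - 2 + k, by omega⟩ := fun k h2 =>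
    hv.eq_of_eq hv' (j - k) _ _ j j' (by simp; omega) (by simp; omega) h
  have h01 : v ⟨0, by omega⟩ < v ⟨1, by omega⟩ :=
    hv.lt_iff.2 (hπ.zero_lt _ _ rfl (by simp))
  have h12 : v ⟨1, by omega⟩ < v ⟨2, by omega⟩ :=
    hv.lt_iff.2 (hπ.one_lt _ _ rfl (by simp))
  rw [key 0 (by omega), key 1 (by omega)] at h01
  rw [key 1 (by omega), key 2 (by omega)] at h12
  replace h01 := hv'.lt_iff.1 h01
  replace h12 := hv'.lt_iff.1 h12
  rcases Nat.mod_two_eq_zero_or_one m with hpar | hpar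
  · exact absurd h01 (hπ.succ_lt (by simp) (by simp; omega) (by simp; omega)).asymm
  · exact absurd h12 (hπ.succ_lt (by simp) (by simp; omega) (by simp; omega)).asymm

/-! ### Rewiring a forest along the tails of marked occurrences -/

/-- The vertices at positions `≥ t` of the occurrences in `S`. -/
def tailVertices (t : ℕ) (S : Finset (Fin n → V)) : Set V :=
  {y | ∃ v ∈ S, ∃ j : Fin n, t ≤ (j : ℕ) ∧ v j = y}

theorem notMem_tailVertices {F : RootedForest V} {t : ℕ} {S : Finset (Fin n → V)}
    {π : Equiv.Perm (Fin n)} (hπ : IsZigzag π)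
    (hS : ∀ v ∈ S, F.IsConsecutiveInstance ⟨n, π⟩ v) {v : Fin n → V} (hv : v ∈ S)
    {j : Fin n} (hj : 2 ≤ (j : ℕ)) (hjt : (j : ℕ) < t) : v j ∉ tailVertices t S := by
  rintro ⟨v', hv', j', hj', e⟩
  obtain rfl := (hS v' hv').position_eq hπ (hS v hv) (by omega) (by omega) e
  omega

variable [Fintype V]

open Classical in
/-- The vertices at positions `t, t + 2, …` of the occurrences in `S` that have `q` at position
`t - 1`. -/
noncomputable def tailGroup (t : ℕ) (S : Finset (Fin n → V)) (q : V) : Finset V :=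
  univ.filter fun x =>
    ∃ v ∈ S, ∃ i j : Fin n, (i : ℕ) + 1 = t ∧ InTail t j ∧ v i = q ∧ v j = x

/-- The relabeling of the tails of the occurrences in `S`. -/
noncomputable def tailReverse (t : ℕ) (S : Finset (Fin n → V)) : V → V :=
  blockReverse (tailGroup t S)

open Classical in
/-- The parent function after the vertices at positions `t, t + 2, …` of the occurrences in `S`
have been permuted by `tailReverse`, each vertex taking along those of its descendants that
are not at positions `≥ t` of occurrences in `S`. -/
noncomputable def rewiredParent (F : RootedForest V) (t : ℕ) (S : Finset (Fin n → V)) (y : V) :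
    Option V :=
  if y ∈ tailVertices t S then (F.parent (tailReverse t S y)).map (tailReverse t S)
  else F.parent y

/-- The image of an occurrence under the rewiring. -/
noncomputable def rewiredInstance (F : RootedForest V) (t : ℕ) (S : Finset (Fin n → V))
    (v : Fin n → V) (j : Fin n) : V :=
  if h : (j : ℕ) = 0 ∧ 1 < n then (F.rewiredParent t S (v ⟨1, h.2⟩)).getD (v j)
  else if (j : ℕ) = 1 then v j else tailReverse t S (v j)

variable {F : RootedForest V} {t : ℕ} {S : Finset (Fin n → V)} {π π' : Equiv.Perm (Fin n)}
  {v : Fin n → V}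

theorem mem_tailGroup {q x : V} : x ∈ tailGroup t S q ↔
    ∃ v ∈ S, ∃ i j : Fin n, (i : ℕ) + 1 = t ∧ InTail t j ∧ v i = q ∧ v j = x := by
  simp [tailGroup]

theorem rewiredInstance_one {j : Fin n} (hj : (j : ℕ) = 1) :
    F.rewiredInstance t S v j = v j := by
  simp [rewiredInstance, hj]

theorem rewiredInstance_of_two_le {j : Fin n} (hj : 2 ≤ (j : ℕ)) :
    F.rewiredInstance t S v j = tailReverse t S (v j) := by
  rw [rewiredInstance, dif_neg (by omega), if_neg (by omega)]

/-- A shared tail vertex has the same position in both occurrences, so climbing from it reaches the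
same vertex at position `t - 1`. -/
theorem tailGroup_disjoint
    (ht : 3 ≤ t) (hπ : IsZigzag π) (hS : ∀ v ∈ S, F.IsConsecutiveInstance ⟨n, π⟩ v)
    (q q' x : V) (h : x ∈ tailGroup t S q) (h' : x ∈ tailGroup t S q') :
    q = q' := by
  obtain ⟨v, hv, i, j, hi, hj, rfl, rfl⟩ := mem_tailGroup.1 h
  obtain ⟨v', hv', i', j', hi', hj', rfl, e⟩ := mem_tailGroup.1 h'
  have h1 := hj.1
  have h2 := hj'.1
  obtain rfl := (hS v' hv').position_eq hπ (hS v hv) (by omega) (by omega) e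
  exact (hS v hv).eq_of_eq (hS v' hv') (j' - i) _ _ j' j' (by omega) (by omega) e.symm

theorem tailReverse_involutive
    (ht : 3 ≤ t) (hπ : IsZigzag π) (hS : ∀ v ∈ S, F.IsConsecutiveInstance ⟨n, π⟩ v) :
    Function.Involutive (tailReverse t S) :=
  blockReverse_involutive (tailGroup_disjoint ht hπ hS)

theorem tailReverse_of_not_inTail
    (ht : 3 ≤ t) (hπ : IsZigzag π) (hS : ∀ v ∈ S, F.IsConsecutiveInstance ⟨n, π⟩ v)
    (hv : v ∈ S) {j : Fin n} (hj : 2 ≤ (j : ℕ))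
    (hT : ¬ InTail t j) : tailReverse t S (v j) = v j := by
  refine blockReverse_of_notMem fun q hq => ?_
  obtain ⟨v', hv', i', j', hi', hj', rfl, e⟩ := mem_tailGroup.1 hq
  have h2 := hj'.1
  obtain rfl := (hS v' hv').position_eq hπ (hS v hv) (by omega) (by omega) e
  exact hT hj'

theorem tailReverse_of_lt
    (ht : 3 ≤ t) (hπ : IsZigzag π) (hS : ∀ v ∈ S, F.IsConsecutiveInstance ⟨n, π⟩ v)
    (hv : v ∈ S) {j : Fin n} (hj : 2 ≤ (j : ℕ))
    (hT : (j : ℕ) < t) : tailReverse t S (v j) = v j :=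
  tailReverse_of_not_inTail ht hπ hS hv hj fun h => absurd h.1 (by omega)

/-- `tailReverse` moves a tail vertex to a tail vertex of an occurrence with the same head. -/
theorem exists_tailReverse_eq
    (ht : 3 ≤ t) (hπ : IsZigzag π) (hS : ∀ v ∈ S, F.IsConsecutiveInstance ⟨n, π⟩ v)
    (hv : v ∈ S) {j : Fin n} (hj : t ≤ (j : ℕ)) :
    ∃ w ∈ S, ∃ m : Fin n, t ≤ (m : ℕ) ∧ (m : ℕ) % 2 = (j : ℕ) % 2 ∧
      tailReverse t S (v j) = w m ∧ ∀ k : Fin n, (k : ℕ) < t → w k = v k := by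
  by_cases hT : InTail t j
  · have hn := j.2
    have hmem : v j ∈ tailGroup t S (v ⟨t - 1, by omega⟩) :=
      mem_tailGroup.2 ⟨v, hv, ⟨t - 1, by omega⟩, j, by simp; omega, hT, rfl, rfl⟩
    obtain ⟨w, hw, i, m, hi, hm, hiq, hmx⟩ := mem_tailGroup.1
      (blockReverse_mem (tailGroup_disjoint ht hπ hS) hmem)
    refine ⟨w, hw, m, hm.1, hm.2.trans hT.2.symm, hmx.symm, fun k hk => ?_⟩
    exact (hS w hw).eq_of_eq (hS v hv) (t - 1 - k) _ _ i ⟨t - 1, by omega⟩ (by omega)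
      (by simp; omega) hiq
  · exact ⟨v, hv, j, hj, rfl, tailReverse_of_not_inTail ht hπ hS hv (by omega) hT,
      fun _ _ => rfl⟩

theorem tailReverse_mem_tailVertices
    (ht : 3 ≤ t) (hπ : IsZigzag π) (hS : ∀ v ∈ S, F.IsConsecutiveInstance ⟨n, π⟩ v)
    {y : V} (hy : y ∈ tailVertices t S) :
    tailReverse t S y ∈ tailVertices t S := by
  obtain ⟨v, hv, j, hj, rfl⟩ := hy
  obtain ⟨w, hw, m, hm, -, e, -⟩ := exists_tailReverse_eq ht hπ hS hv hj
  exact ⟨w, hw, m, hm, e.symm⟩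

theorem tailReverse_mem_tailVertices_iff
    (ht : 3 ≤ t) (hπ : IsZigzag π) (hS : ∀ v ∈ S, F.IsConsecutiveInstance ⟨n, π⟩ v)
    {y : V} :
    tailReverse t S y ∈ tailVertices t S ↔ y ∈ tailVertices t S := by
  refine ⟨fun h => ?_, tailReverse_mem_tailVertices ht hπ hS⟩
  rw [← tailReverse_involutive ht hπ hS y]
  exact tailReverse_mem_tailVertices ht hπ hS h

theorem tailReverse_mem_tailGroup_iff
    (ht : 3 ≤ t) (hπ : IsZigzag π) (hS : ∀ v ∈ S, F.IsConsecutiveInstance ⟨n, π⟩ v)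
    {q y : V} :
    tailReverse t S y ∈ tailGroup t S q ↔ y ∈ tailGroup t S q := by
  refine ⟨fun h => ?_, blockReverse_mem (tailGroup_disjoint ht hπ hS)⟩
  rw [← tailReverse_involutive ht hπ hS y]
  exact blockReverse_mem (tailGroup_disjoint ht hπ hS) h

theorem rewiredParent_tailReverse
    (ht : 3 ≤ t) (hπ : IsZigzag π) (hS : ∀ v ∈ S, F.IsConsecutiveInstance ⟨n, π⟩ v)
    (hv : v ∈ S) {i j : Fin n} (h : (i : ℕ) + 1 = j)
    (hj : t ≤ (j : ℕ)) :
    F.rewiredParent t S (tailReverse t S (v j)) = some (tailReverse t S (v i)) := by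
  rw [rewiredParent, if_pos (tailReverse_mem_tailVertices ht hπ hS ⟨v, hv, j, hj, rfl⟩),
    tailReverse_involutive ht hπ hS, (hS v hv).parent_eq h, Option.map_some]

theorem rewiredParent_rewiredInstance
    (ht : 3 ≤ t) (hπ : IsZigzag π) (hS : ∀ v ∈ S, F.IsConsecutiveInstance ⟨n, π⟩ v)
    (hv : v ∈ S) {i j : Fin n} (h : (i : ℕ) + 1 = j) :
    F.rewiredParent t S (F.rewiredInstance t S v j) = some (F.rewiredInstance t S v i) := by
  have hn := j.2
  rcases lt_trichotomy (j : ℕ) 2 with hj | hj | hj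
  -- Position 0 of the image is by definition the new parent of `v 1`, so it only remains to see
  -- that this parent exists and the default of `getD` is not used.
  · have hi0 : (i : ℕ) = 0 := by omega
    have hj1 : j = ⟨1, by omega⟩ := Fin.ext (by simp; omega)
    rw [rewiredInstance_one (by omega), rewiredInstance, dif_pos ⟨hi0, by omega⟩, ← hj1]
    obtain ⟨y, hy⟩ : ∃ y, F.rewiredParent t S (v j) = some y := by
      by_cases hE : v j ∈ tailVertices t S
      · obtain ⟨w, hw, m, hm, e⟩ := tailReverse_mem_tailVertices ht hπ hS hE
        rw [← tailReverse_involutive ht hπ hS (v j), ← e]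
        exact ⟨_, rewiredParent_tailReverse ht hπ hS hw (i := ⟨m - 1, by omega⟩)
          (by simp; omega) hm⟩
      · exact ⟨v i, by rw [rewiredParent, if_neg hE, (hS v hv).parent_eq h]⟩
    rw [hy, Option.getD_some]
  · rw [rewiredInstance_of_two_le (by omega), rewiredInstance_one (by omega),
      tailReverse_of_lt ht hπ hS hv (by omega) (by omega), rewiredParent,
      if_neg (notMem_tailVertices hπ hS hv (by omega) (by omega)), (hS v hv).parent_eq h]
  · rw [rewiredInstance_of_two_le (by omega), rewiredInstance_of_two_le (by omega)]
    rcases lt_or_ge (j : ℕ) t with hjt | hjt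
    · rw [tailReverse_of_lt ht hπ hS hv (by omega) (by omega),
        tailReverse_of_lt ht hπ hS hv (by omega) (by omega), rewiredParent,
        if_neg (notMem_tailVertices hπ hS hv (by omega) (by omega)), (hS v hv).parent_eq h]
    · exact rewiredParent_tailReverse ht hπ hS hv h hjt

/-- Induction on ancestors in the old forest. The new path from a tail vertex climbs along a rewired
occurrence to the vertex at position `t - 1`, which is an old ancestor of that vertex; every other
vertex keeps its parent. -/
theorem rewiredParent_acyclic
    (ht : 3 ≤ t) (hπ : IsZigzag π) (hS : ∀ v ∈ S, F.IsConsecutiveInstance ⟨n, π⟩ v) :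
    WellFounded fun u v : V => F.rewiredParent t S v = some u := by
  refine ⟨fun y => ?_⟩
  induction y using F.acyclic.transGen.induction with
  | _ y ih =>
  by_cases hE : y ∈ tailVertices t S
  · have key : ∀ v ∈ S, ∀ i : Fin n, (i : ℕ) + 1 = t →
        Acc (fun u v : V => F.rewiredParent t S v = some u) (v i) → ∀ d : ℕ, ∀ j : Fin n,
        (i : ℕ) + d = j → Acc (fun u v : V => F.rewiredParent t S v = some u)
          (F.rewiredInstance t S v j) := by
      intro v hv i hi hacc d
      induction d with
      | zero =>
        intro j hj
        obtain rfl : i = j := Fin.ext (by omega)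
        rwa [rewiredInstance_of_two_le (by omega),
          tailReverse_of_lt ht hπ hS hv (by omega) (by omega)]
      | succ d ihd =>
        intro j hj
        have hn := j.2
        refine ⟨_, fun u hu => ?_⟩
        rw [rewiredParent_rewiredInstance ht hπ hS hv (i := ⟨i + d, by omega⟩)
          (by simp; omega)] at hu
        exact Option.some_injective _ hu ▸ ihd _ rfl
    have anc : ∀ v ∈ S, ∀ d : ℕ, ∀ i j : Fin n, (i : ℕ) + (d + 1) = j →
        Relation.TransGen (fun u v : V => F.parent v = some u) (v i) (v j) := by
      intro v hv d
      induction d with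
      | zero => exact fun i j hij => .single ((hS v hv).parent_eq hij)
      | succ d ihd =>
        intro i j hij
        have hn := j.2
        exact .tail (ihd i ⟨i + (d + 1), by omega⟩ rfl) ((hS v hv).parent_eq (by simp; omega))
    obtain ⟨v, hv, j, hj, rfl⟩ := hE
    obtain ⟨w, hw, m, hm, -, e, hwv⟩ := exists_tailReverse_eq ht hπ hS hv hj
    have hn := j.2
    have hacc := ih (v ⟨t - 1, by omega⟩) (anc v hv (j - t) _ j (by simp; omega))
    rw [← hwv _ (by simp; omega)] at hacc
    have := key w hw ⟨t - 1, by omega⟩ (by simp; omega) hacc (m - (t - 1)) m (by simp; omega)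
    rwa [rewiredInstance_of_two_le (by omega), ← e, tailReverse_involutive ht hπ hS] at this
  · refine ⟨_, fun u hu => ih u (.single ?_)⟩
    rwa [rewiredParent, if_neg hE] at hu

theorem rewiredInstance_of_inTail (ht : 3 ≤ t) {k : Fin n} (hk : InTail t k) :
    F.rewiredInstance t S v k = tailReverse t S (v k) :=
  rewiredInstance_of_two_le (by have := hk.1; omega)

/-- The new label belongs to an occurrence `w` that agrees with `v` before `t`. Convexity of the
flipped letters settles `k < t`; for `k ≥ t` of the other parity, the common vertex at position 2
lies between the two labels. -/
theorem tailReverse_compare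
    (hf : IsFlip t π π') (hπ : IsZigzag π) (hS : ∀ v ∈ S, F.IsConsecutiveInstance ⟨n, π⟩ v)
    (hv : v ∈ S) {i k : Fin n} (hi : InTail t i) (hk : ¬ InTail t k) :
    (tailReverse t S (v i) < v k ↔ π i < π k) ∧ (v k < tailReverse t S (v i) ↔ π k < π i) := by
  have ht := hf.three_le
  have hn := i.2
  have hit := hi.1
  obtain ⟨w, hw, m, hm, hpar, e, hwv⟩ := exists_tailReverse_eq ht hπ hS hv hit
  have hmT : InTail t m := ⟨hm, hpar.trans hi.2⟩
  have hik : i ≠ k := fun h => hk (h ▸ hi)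
  have hmk : m ≠ k := fun h => hk (h ▸ hmT)
  rw [e]
  rcases lt_or_ge (k : ℕ) t with hkt | hkt
  · rw [← hwv k hkt, (hS w hw).lt_iff, (hS w hw).lt_iff]
    have h1 := hf.convex m i k hmT hi hk
    refine ⟨h1, ?_⟩
    rw [← not_le, ← not_le, not_iff_not, le_iff_lt_or_eq, le_iff_lt_or_eq, h1]
    simp [hik, hmk]
  · have hkpar : (k : ℕ) % 2 ≠ t % 2 := fun h => hk ⟨hkt, h⟩
    have h2 := hwv ⟨2, by omega⟩ (by simp; omega)
    rcases Nat.mod_two_eq_zero_or_one t with htp | htp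
    · have a1 := hπ.two_lt ⟨2, by omega⟩ i rfl (by omega) (by rw [hi.2, htp])
      have a2 := hπ.two_lt ⟨2, by omega⟩ m rfl (by omega) (by rw [hmT.2, htp])
      have a3 := hπ.lt_two ⟨2, by omega⟩ k rfl (by omega) (by omega)
      have b2 := (hS w hw).lt_iff.2 a2
      have b3 := (hS v hv).lt_iff.2 a3
      rw [h2] at b2
      exact ⟨iff_of_false (b3.trans b2).asymm (a3.trans a1).asymm,
        iff_of_true (b3.trans b2) (a3.trans a1)⟩
    · have a1 := hπ.lt_two ⟨2, by omega⟩ i rfl (by omega) (by rw [hi.2, htp])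
      have a2 := hπ.lt_two ⟨2, by omega⟩ m rfl (by omega) (by rw [hmT.2, htp])
      have a3 := hπ.two_lt ⟨2, by omega⟩ k rfl (by omega) (by omega)
      have b2 := (hS w hw).lt_iff.2 a2
      have b3 := (hS v hv).lt_iff.2 a3
      rw [h2] at b2
      exact ⟨iff_of_true (b2.trans b3) (a1.trans a3),
        iff_of_false (b2.trans b3).asymm (a1.trans a3).asymm⟩

theorem rewiredInstance_of_not_inTail
    (hf : IsFlip t π π') (hπ : IsZigzag π) (hS : ∀ v ∈ S, F.IsConsecutiveInstance ⟨n, π⟩ v)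
    (hv : v ∈ S) {k : Fin n} (h : 1 ≤ (k : ℕ))
    (hk : ¬ InTail t k) : F.rewiredInstance t S v k = v k := by
  rcases eq_or_lt_of_le h with h1 | h1
  · exact rewiredInstance_one h1.symm
  · rw [rewiredInstance_of_two_le h1, tailReverse_of_not_inTail hf.three_le hπ hS hv h1 hk]

theorem rewiredInstance_lt_iff_of_pos
    (hf : IsFlip t π π') (hπ : IsZigzag π) (hS : ∀ v ∈ S, F.IsConsecutiveInstance ⟨n, π⟩ v)
    (hv : v ∈ S) {i j : Fin n} (hi : 1 ≤ (i : ℕ))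
    (hj : 1 ≤ (j : ℕ)) :
    F.rewiredInstance t S v i < F.rewiredInstance t S v j ↔ π' i < π' j := by
  have ht := hf.three_le
  by_cases hiT : InTail t i <;> by_cases hjT : InTail t j
  · have hn := i.2
    have hit := hiT.1
    have hmem : ∀ k, InTail t k → v k ∈ tailGroup t S (v ⟨t - 1, by omega⟩) := fun k hk =>
      mem_tailGroup.2 ⟨v, hv, ⟨t - 1, by omega⟩, k, by simp; omega, hk, rfl, rfl⟩
    rw [rewiredInstance_of_inTail ht hiT, rewiredInstance_of_inTail ht hjT,
      hf.reverse i j hiT hjT, ← (hS v hv).lt_iff]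
    exact blockReverse_lt_iff (tailGroup_disjoint ht hπ hS) (hmem i hiT) (hmem j hjT)
  · rw [rewiredInstance_of_inTail ht hiT, rewiredInstance_of_not_inTail hf hπ hS hv hj hjT,
      hf.same i j (fun h => hjT h.2), (tailReverse_compare hf hπ hS hv hiT hjT).1]
  · rw [rewiredInstance_of_inTail ht hjT, rewiredInstance_of_not_inTail hf hπ hS hv hi hiT,
      hf.same i j (fun h => hiT h.1), (tailReverse_compare hf hπ hS hv hjT hiT).2]
  · rw [rewiredInstance_of_not_inTail hf hπ hS hv hi hiT,
      rewiredInstance_of_not_inTail hf hπ hS hv hj hjT, hf.same i j (fun h => hiT h.1),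
      (hS v hv).lt_iff]

/-- The delicate case is an occurrence that begins inside the tail of another one, so that the
parent of `v 1` may change. The ascent into `v 1` forces an even position there; the reversal
preserves parity, so the new position also ends an ascent. -/
theorem rewiredInstance_zero_lt_one
    (hf : IsFlip t π π') (hπ : IsZigzag π) (hS : ∀ v ∈ S, F.IsConsecutiveInstance ⟨n, π⟩ v)
    (hv : v ∈ S) {i j : Fin n} (hi : (i : ℕ) = 0)
    (hj : (j : ℕ) = 1) : F.rewiredInstance t S v i < F.rewiredInstance t S v j := by
  have ht := hf.three_le
  have hp := rewiredParent_rewiredInstance ht hπ hS hv (show (i : ℕ) + 1 = j by omega)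
  rw [rewiredInstance_one hj] at hp ⊢
  by_cases hE : v j ∈ tailVertices t S
  · obtain ⟨u, hu, k, hk, e⟩ := hE
    obtain ⟨w, hw, m, hm, hpar, e', -⟩ := exists_tailReverse_eq ht hπ hS hu hk
    have hkn := k.2
    have hmn := m.2
    have hlt : v i < v j := (hS v hv).lt_iff.2 (hπ.zero_lt i j hi (by omega))
    have hk1 : u ⟨k - 1, by omega⟩ = v i :=
      (hS u hu).eq_of_eq (hS v hv) 1 _ _ k j (by simp; omega) (by omega) e
    rw [← e, ← hk1, (hS u hu).lt_iff] at hlt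
    have hkpar : (k : ℕ) % 2 = 0 := by
      by_contra hne
      exact hlt.asymm (hπ.succ_lt (by simp; omega) (by omega) (by omega))
    have hwm : F.rewiredInstance t S w m = v j := by
      rw [rewiredInstance_of_two_le (by omega), ← e', tailReverse_involutive ht hπ hS, e]
    have hp' := rewiredParent_rewiredInstance ht hπ hS hw (i := ⟨m - 1, by omega⟩) (j := m)
      (by simp; omega)
    rw [hwm, hp] at hp'
    rw [Option.some_injective _ hp', ← hwm,
      rewiredInstance_lt_iff_of_pos hf hπ hS hw (by simp; omega) (by omega)]
    exact (hπ.of_isFlip hf).lt_succ (by simp; omega) (by omega) (by omega)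
  · rw [rewiredParent, if_neg hE, (hS v hv).parent_eq (show (i : ℕ) + 1 = j by omega)] at hp
    rw [← Option.some_injective _ hp, (hS v hv).lt_iff]
    exact hπ.zero_lt i j hi (by omega)

theorem rewiredInstance_lt_iff
    (hf : IsFlip t π π') (hπ : IsZigzag π) (hS : ∀ v ∈ S, F.IsConsecutiveInstance ⟨n, π⟩ v)
    (hv : v ∈ S) (i j : Fin n) :
    F.rewiredInstance t S v i < F.rewiredInstance t S v j ↔ π' i < π' j := by
  have hπ' := hπ.of_isFlip hf
  have zero : ∀ i j : Fin n, (i : ℕ) = 0 → 1 ≤ (j : ℕ) →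
      F.rewiredInstance t S v i < F.rewiredInstance t S v j := by
    intro i j hi hj
    have hn := j.2
    have h01 := rewiredInstance_zero_lt_one hf hπ hS hv (i := i) (j := ⟨1, by omega⟩) hi rfl
    rcases eq_or_lt_of_le hj with h1 | h1
    · rwa [show (⟨1, by omega⟩ : Fin n) = j from Fin.ext h1] at h01
    · exact h01.trans ((rewiredInstance_lt_iff_of_pos hf hπ hS hv (by simp) hj).2
        (hπ'.one_lt _ _ rfl h1))
  rcases Nat.eq_zero_or_pos (i : ℕ) with hi | hi <;> rcases Nat.eq_zero_or_pos (j : ℕ) with hj | hj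
  · obtain rfl : i = j := Fin.ext (by omega)
    simp
  · exact iff_of_true (zero i j hi hj) (hπ'.zero_lt i j hi hj)
  · exact iff_of_false (zero j i hj hi).asymm (hπ'.zero_lt j i hj hi).asymm
  · exact rewiredInstance_lt_iff_of_pos hf hπ hS hv hi hj

/-! ### The bijection of marked forests and inclusion-exclusion -/

/-- A forest together with a set of marked occurrences of a pattern. -/
def Marked (V : Type*) [LinearOrder V] (π : Equiv.Perm (Fin n)) : Type _ :=
  {p : RootedForest V × Finset (Fin n → V) // ∀ v ∈ p.2, p.1.IsConsecutiveInstance ⟨n, π⟩ v}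

open Classical in
/-- Reverses the tails of the marked occurrences. -/
noncomputable def Marked.flip (hf : IsFlip t π π') (hπ : IsZigzag π) (p : Marked V π) :
    Marked V π' :=
  ⟨(⟨p.1.1.rewiredParent t p.1.2, rewiredParent_acyclic hf.three_le hπ p.2⟩,
    p.1.2.image (p.1.1.rewiredInstance t p.1.2)), by
    intro v' hv'
    obtain ⟨v, hv, rfl⟩ := mem_image.1 hv'
    exact ⟨fun i j h => rewiredParent_rewiredInstance hf.three_le hπ p.2 hv h,
      rewiredInstance_lt_iff hf hπ p.2 hv⟩⟩

/-- Each group is stable under the reversal, and the vertices at position `t - 1 ≥ 2` are fixed. So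
the flipped marks define the same reversal, and flipping back undoes the conjugation of the parent
map. -/
theorem Marked.tailGroup_flip (hf : IsFlip t π π') (hπ : IsZigzag π) (p : Marked V π) :
    tailGroup t (p.flip hf hπ).1.2 = tailGroup t p.1.2 := by
  have ht := hf.three_le
  ext q x
  rw [← tailReverse_mem_tailGroup_iff ht hπ p.2, mem_tailGroup, mem_tailGroup]
  simp only [Marked.flip, mem_image, exists_exists_and_eq_and]
  refine exists_congr fun v => and_congr_right fun hv => exists_congr fun i => exists_congr fun j =>
    and_congr_right fun hi => and_congr_right fun hj => ?_
  rw [rewiredInstance_of_inTail ht hj, rewiredInstance_of_two_le (by omega),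
    tailReverse_of_lt ht hπ p.2 hv (by omega) (by omega)]
  exact and_congr_right fun _ => (tailReverse_involutive ht hπ p.2).eq_iff

theorem Marked.tailReverse_flip (hf : IsFlip t π π') (hπ : IsZigzag π) (p : Marked V π) :
    tailReverse t (p.flip hf hπ).1.2 = tailReverse t p.1.2 := by
  rw [tailReverse, Marked.tailGroup_flip, tailReverse]

theorem Marked.tailVertices_flip (hf : IsFlip t π π') (hπ : IsZigzag π) (p : Marked V π) :
    tailVertices t (p.flip hf hπ).1.2 = tailVertices t p.1.2 := by
  have ht := hf.three_le
  ext x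
  rw [← tailReverse_mem_tailVertices_iff ht hπ p.2]
  simp only [Marked.flip, tailVertices, Set.mem_ofPred_eq, mem_image, exists_exists_and_eq_and]
  refine exists_congr fun v => and_congr_right fun hv => exists_congr fun j =>
    and_congr_right fun hj => ?_
  rw [rewiredInstance_of_two_le (by omega)]
  exact (tailReverse_involutive ht hπ p.2).eq_iff

theorem Marked.rewiredParent_flip (hf : IsFlip t π π') (hπ : IsZigzag π) (p : Marked V π) (y : V) :
    (p.flip hf hπ).1.1.rewiredParent t (p.flip hf hπ).1.2 y = p.1.1.parent y := by
  have ht := hf.three_le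
  have hinv := tailReverse_involutive ht hπ p.2
  have hpar : ∀ z, (p.flip hf hπ).1.1.parent z = p.1.1.rewiredParent t p.1.2 z := fun _ => rfl
  by_cases hy : y ∈ tailVertices t p.1.2
  · rw [rewiredParent, if_pos (by rwa [p.tailVertices_flip]), p.tailReverse_flip, hpar,
      rewiredParent, if_pos (tailReverse_mem_tailVertices ht hπ p.2 hy), Option.map_map,
      hinv.comp_self, Option.map_id, id, hinv]
  · rw [rewiredParent, if_neg (by rwa [p.tailVertices_flip]), hpar, rewiredParent, if_neg hy]

theorem Marked.rewiredInstance_flip (hf : IsFlip t π π') (hπ : IsZigzag π) (p : Marked V π)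
    (hv : v ∈ p.1.2) :
    (p.flip hf hπ).1.1.rewiredInstance t (p.flip hf hπ).1.2 (p.1.1.rewiredInstance t p.1.2 v) =
      v := by
  have ht := hf.three_le
  funext j
  have hn := j.2
  rcases lt_or_ge (j : ℕ) 2 with hj | hj
  · obtain hj | hj : (j : ℕ) = 1 ∨ (j : ℕ) = 0 := by omega
    · rw [rewiredInstance_one hj, rewiredInstance_one hj]
    · by_cases h1 : 1 < n
      · rw [rewiredInstance, dif_pos ⟨hj, h1⟩, p.rewiredParent_flip, rewiredInstance_one rfl,
          (p.2 v hv).parent_eq (i := j) (by simp [hj]), Option.getD_some]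
      -- With `n ≤ 1` there are no positions `≥ t`, so all groups are empty.
      · have hid : ∀ x, tailReverse t p.1.2 x = x := fun x => blockReverse_of_notMem fun q hq => by
          obtain ⟨-, -, -, k, -, hk, -⟩ := mem_tailGroup.1 hq
          have := hk.1
          omega
        simp [rewiredInstance, hj, h1, p.tailReverse_flip, hid]
  · rw [rewiredInstance_of_two_le hj, rewiredInstance_of_two_le hj, p.tailReverse_flip,
      tailReverse_involutive ht hπ p.2]

theorem Marked.flip_flip (hf : IsFlip t π π') (hπ : IsZigzag π) (p : Marked V π) :
    (p.flip hf hπ).flip hf.symm (hπ.of_isFlip hf) = p := by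
  refine Subtype.ext (Prod.ext (RootedForest.ext (funext (p.rewiredParent_flip hf hπ))) ?_)
  change ((p.1.2.image _).image _) = _
  rw [image_image]
  exact (image_congr fun v hv => p.rewiredInstance_flip hf hπ hv).trans image_id

theorem Marked.card_flip (hf : IsFlip t π π') (hπ : IsZigzag π) (p : Marked V π) :
    (p.flip hf hπ).1.2.card = p.1.2.card :=
  card_image_of_injOn fun v hv w hw h => by
    rw [← p.rewiredInstance_flip hf hπ hv, ← p.rewiredInstance_flip hf hπ hw]
    exact congrArg _ h

instance {π : Equiv.Perm (Fin n)} : Finite (Marked V π) := Subtype.finite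

open Classical in
/-- The forests avoiding a pattern are counted by the marked forests, with signs. -/
theorem card_consecutivelyAvoids_eq_sum (π : Equiv.Perm (Fin n)) [Fintype (Marked V π)] :
    (Nat.card {F : RootedForest V // F.ConsecutivelyAvoids {⟨n, π⟩}} : ℤ) =
      ∑ p : Marked V π, (-1 : ℤ) ^ p.1.2.card := by
  have := Fintype.ofFinite (RootedForest V)
  let I : RootedForest V → Finset (Fin n → V) := fun F =>
    univ.filter fun v => F.IsConsecutiveInstance ⟨n, π⟩ v
  have hI : ∀ F : RootedForest V, F.ConsecutivelyAvoids {⟨n, π⟩} ↔ I F = ∅ := by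
    intro F
    simp only [ConsecutivelyAvoids, Set.mem_singleton_iff, forall_eq, ConsecutivelyContains,
      not_exists, I, filter_eq_empty_iff, mem_univ, forall_const]
  rw [Nat.card_eq_fintype_card, Fintype.card_subtype, card_filter]
  push_cast
  calc ∑ F : RootedForest V, (if F.ConsecutivelyAvoids {⟨n, π⟩} then (1 : ℤ) else 0)
      = ∑ F : RootedForest V, ∑ S ∈ (I F).powerset, (-1 : ℤ) ^ S.card := by
        refine sum_congr rfl fun F _ => ?_
        -- The signed sum over the subsets of a finite set is 1 if the set is empty and 0 otherwise.
        rw [sum_powerset_neg_one_pow_card]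
        simp only [hI]
    _ = _ := by
        rw [sum_sigma']
        symm
        refine sum_bij' (fun p _ => ⟨p.1.1, p.1.2⟩)
          (fun x hx => ⟨(x.1, x.2), fun v hv =>
            (mem_filter.1 (mem_powerset.1 (mem_sigma.1 hx).2 hv)).2⟩) (fun p _ => ?_)
          (fun _ _ => mem_univ _) (fun _ _ => rfl) (fun _ _ => rfl) (fun _ _ => rfl)
        exact mem_sigma.2 ⟨mem_univ _, mem_powerset.2 fun v hv =>
          mem_filter.2 ⟨mem_univ _, p.2 v hv⟩⟩

end RootedForest

theorem IsFlip.cForestWilfEquivalent {n t : ℕ} {π π' : Equiv.Perm (Fin n)} (hf : IsFlip t π π')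
    (hπ : IsZigzag π) : CForestWilfEquivalent {⟨n, π⟩} {⟨n, π'⟩} := by
  intro N
  have := Fintype.ofFinite (RootedForest.Marked (Fin N) π)
  have := Fintype.ofFinite (RootedForest.Marked (Fin N) π')
  have hπ' := hπ.of_isFlip hf
  rw [numConsecutivelyAvoiding, numConsecutivelyAvoiding, ← Int.natCast_inj,
    RootedForest.card_consecutivelyAvoids_eq_sum, RootedForest.card_consecutivelyAvoids_eq_sum]
  refine Fintype.sum_equiv ⟨fun p => p.flip hf hπ, fun p => p.flip hf.symm hπ',
    fun p => p.flip_flip hf hπ, fun p => p.flip_flip hf.symm hπ'⟩ _ _ fun p => ?_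
  exact congrArg _ (p.card_flip hf hπ).symm

/-! ### Complementation of patterns -/

section Complement

/-- Reverses the order of the labels. -/
def RootedForest.relabelRev {N : ℕ} (F : RootedForest (Fin N)) : RootedForest (Fin N) where
  parent y := (F.parent y.rev).map Fin.rev
  acyclic := by
    refine Subrelation.wf (fun {u v} h => ?_) (InvImage.wf Fin.rev F.acyclic)
    obtain ⟨w, hw, rfl⟩ := Option.map_eq_some_iff.1 h
    simpa [InvImage] using hw

theorem RootedForest.relabelRev_involutive {N : ℕ} :
    Function.Involutive (RootedForest.relabelRev (N := N)) := by
  intro F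
  ext1
  funext y
  simp [relabelRev, Option.map_map, Function.comp_def]

theorem RootedForest.ConsecutivelyContains.relabelRev {n N : ℕ} {F : RootedForest (Fin N)}
    {π : Equiv.Perm (Fin n)} (h : F.ConsecutivelyContains ⟨n, π⟩) :
    F.relabelRev.ConsecutivelyContains ⟨n, π.trans Fin.revPerm⟩ := by
  obtain ⟨v, hp, ho⟩ := h
  refine ⟨fun i => (v i).rev, fun i j hij => ?_, fun i j => ?_⟩
  · simp [RootedForest.relabelRev, hp i j hij]
  · simpa using ho j i

theorem cForestWilfEquivalent_complement {n : ℕ} (π : Equiv.Perm (Fin n)) :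
    CForestWilfEquivalent {⟨n, π⟩} {⟨n, π.trans Fin.revPerm⟩} := by
  intro N
  refine Nat.card_congr (RootedForest.relabelRev_involutive.toPerm.subtypeEquiv fun F => ?_)
  simp only [RootedForest.ConsecutivelyAvoids, Set.mem_singleton_iff, forall_eq,
    Function.Involutive.coe_toPerm]
  refine not_congr ⟨fun h => h.relabelRev, fun h => ?_⟩
  have h' := h.relabelRev
  rw [RootedForest.relabelRev_involutive F] at h'
  convert h' using 2
  ext i
  simp

end Complement

/-! ### The family of zigzag patterns indexed by bits -/

section Family

/-- The offset of the `j`-th letter within its block of letters of the same parity: the later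
letters of the block lie on the side of the `j`-th letter given by the sign of `s j`. -/
noncomputable def zigzagOffset (s : ℕ → ℚ) : ℕ → ℚ
  | 0 => 0
  | 1 => 0
  | j + 2 => zigzagOffset s j + s j / 2 ^ j

/-- The later terms decay geometrically and cannot outweigh `s i / 2 ^ i` when `|s i| = 1`. The
subtracted term on the right keeps the inequality strict enough to fix the sign and lets the
induction close. -/
theorem abs_zigzagOffset_sub_le {s : ℕ → ℚ} (hs : ∀ i, |s i| ≤ 1) (i d : ℕ) :
    |zigzagOffset s (i + 2 * d + 2) - zigzagOffset s i - s i / 2 ^ i| ≤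
      1 / 2 ^ i - 2 / 2 ^ (i + 2 * d + 2) := by
  induction d with
  | zero =>
    have : (0 : ℚ) < 2 ^ i := by positivity
    simp only [zigzagOffset, mul_zero, add_zero, pow_add]
    rw [show ∀ a b : ℚ, a + b - a - b = 0 from fun a b => by ring, abs_zero]
    rw [sub_nonneg, div_le_div_iff₀ (by positivity) (by positivity)]
    linarith
  | succ d ih =>
    rw [show i + 2 * (d + 1) + 2 = (i + 2 * d + 2) + 2 by ring, zigzagOffset]
    set k := i + 2 * d + 2
    have hk : |s k / 2 ^ k| ≤ 1 / 2 ^ k := by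
      rw [abs_div, abs_of_pos (show (0 : ℚ) < 2 ^ k by positivity)]
      gcongr
      exact hs k
    have h2 : (2 : ℚ) / 2 ^ (k + 2) = (1 / 2 ^ k) / 2 := by
      rw [pow_add]; field_simp
    have h3 : (2 : ℚ) / 2 ^ k = 2 * (1 / 2 ^ k) := by ring
    have h4 : (0 : ℚ) < 1 / 2 ^ k := by positivity
    rw [h2]
    rw [h3] at ih
    rw [abs_le] at ih hk ⊢
    constructor <;> linarith [ih.1, ih.2, hk.1, hk.2]

/-- `π i < π j` for `i < j` in the zigzag pattern in which the letter `i ≥ 3` is below all later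
letters of the same parity if `b i`, and above them otherwise. -/
def ZigzagUp (b : ℕ → Prop) (i j : ℕ) : Prop :=
  i ≤ 1 ∨ (i = 2 ∧ j % 2 = 0) ∨ (3 ≤ i ∧ i % 2 ≠ j % 2 ∧ i % 2 = 1) ∨
    (3 ≤ i ∧ i % 2 = j % 2 ∧ b i)

theorem exists_perm_lt_iff {n : ℕ} (κ : Fin n → ℚ) (hκ : Function.Injective κ) :
    ∃ π : Equiv.Perm (Fin n), ∀ i j, π i < π j ↔ κ i < κ j := by
  have hmono : StrictMono (κ ∘ Tuple.sort κ) :=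
    (Tuple.monotone_sort κ).strictMono_of_injective (hκ.comp (Tuple.sort κ).injective)
  refine ⟨(Tuple.sort κ).symm, fun i j => ?_⟩
  simpa using (hmono.lt_iff_lt (a := (Tuple.sort κ).symm i) (b := (Tuple.sort κ).symm j)).symm

open Classical in
theorem exists_zigzag (n : ℕ) (b : ℕ → Prop) :
    ∃ π : Equiv.Perm (Fin n), ∀ i j : Fin n, i < j → (π i < π j ↔ ZigzagUp b i j) := by
  let s : ℕ → ℚ := fun i => if 3 ≤ i then (if b i then 1 else -1) else 0
  have hs : ∀ i, |s i| ≤ 1 := by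
    intro i
    simp only [s]
    split_ifs <;> norm_num
  -- Offsets are at most 2 in absolute value, so the blocks around `-3` and `3` stay on their sides
  -- of 0 and above `-9`.
  let κ : ℕ → ℚ := fun j =>
    if j = 0 then -10 else if j = 1 then -9 else if j = 2 then 0
    else if j % 2 = 1 then -3 + zigzagOffset s j else 3 + zigzagOffset s j
  have hoff : ∀ j, |zigzagOffset s j| ≤ 2 := by
    intro j
    obtain rfl | rfl | ⟨i, d, hi, rfl⟩ : j = 0 ∨ j = 1 ∨ ∃ i d, i < 2 ∧ j = i + 2 * d + 2 := by
      by_cases h : j < 2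
      · omega
      · exact Or.inr (Or.inr ⟨j % 2, j / 2 - 1, by omega, by omega⟩)
    · simp [zigzagOffset]
    · simp [zigzagOffset]
    · have h := abs_zigzagOffset_sub_le hs i d
      have h0 : zigzagOffset s i = 0 := by interval_cases i <;> rfl
      have h1 : s i = 0 := if_neg (by omega)
      have h2 : (1 : ℚ) / 2 ^ i ≤ 1 := by interval_cases i <;> norm_num
      have h3 : (0 : ℚ) ≤ 2 / 2 ^ (i + 2 * d + 2) := by positivity
      rw [h0, h1, zero_div, sub_zero, sub_zero] at h
      linarith
  have hup : ∀ i j, i < j → ((κ i < κ j ↔ ZigzagUp b i j) ∧ κ i ≠ κ j) := by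
    intro i j hij
    have hi := abs_le.1 (hoff i)
    have hj := abs_le.1 (hoff j)
    have of_lt : κ i < κ j → ZigzagUp b i j → ((κ i < κ j ↔ ZigzagUp b i j) ∧ κ i ≠ κ j) :=
      fun h h' => ⟨iff_of_true h h', h.ne⟩
    have of_gt : κ j < κ i → ¬ ZigzagUp b i j → ((κ i < κ j ↔ ZigzagUp b i j) ∧ κ i ≠ κ j) :=
      fun h h' => ⟨iff_of_false h.asymm h', h.ne'⟩
    have κ_low : ∀ k, 3 ≤ k → k % 2 = 1 → κ k = -3 + zigzagOffset s k := fun k h h' => by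
      simp [κ, h', show k ≠ 0 by omega, show k ≠ 1 by omega, show k ≠ 2 by omega]
    have κ_high : ∀ k, 3 ≤ k → k % 2 = 0 → κ k = 3 + zigzagOffset s k := fun k h h' => by
      simp [κ, h', show k ≠ 0 by omega, show k ≠ 1 by omega, show k ≠ 2 by omega]
    have κ_zero : κ 0 = -10 := rfl
    have κ_one : κ 1 = -9 := rfl
    have κ_two : κ 2 = 0 := rfl
    have κ_gt : ∀ k, 2 ≤ k → -9 < κ k := by
      intro k hk
      have h := abs_le.1 (hoff k)
      obtain rfl | h3 := eq_or_lt_of_le hk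
      · linarith
      rcases Nat.mod_two_eq_zero_or_one k with hp | hp
      · linarith [κ_high k h3 hp, h.1]
      · linarith [κ_low k h3 hp, h.1]
    obtain rfl | rfl | rfl | hi3 : i = 0 ∨ i = 1 ∨ i = 2 ∨ 3 ≤ i := by omega
    · refine of_lt ?_ (Or.inl (by omega))
      obtain rfl | h2 := eq_or_lt_of_le (show 1 ≤ j from hij)
      · norm_num [κ_zero, κ_one]
      · linarith [κ_gt j h2]
    · exact of_lt (by linarith [κ_gt j hij]) (Or.inl le_rfl)
    · rcases Nat.mod_two_eq_zero_or_one j with hp | hp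
      · exact of_lt (by linarith [κ_high j hij hp, hj.1]) (Or.inr (Or.inl ⟨rfl, hp⟩))
      · refine of_gt (by linarith [κ_low j hij hp, hj.2]) ?_
        unfold ZigzagUp
        omega
    · have hj3 : 3 ≤ j := by omega
      by_cases hpar : i % 2 = j % 2
      · have hκ : κ j - κ i = zigzagOffset s j - zigzagOffset s i := by
          rcases Nat.mod_two_eq_zero_or_one i with hp | hp
          · rw [κ_high i hi3 hp, κ_high j hj3 (hpar ▸ hp)]
            ring
          · rw [κ_low i hi3 hp, κ_low j hj3 (hpar ▸ hp)]
            ring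
        have h := abs_zigzagOffset_sub_le hs i ((j - i) / 2 - 1)
        rw [show i + 2 * ((j - i) / 2 - 1) + 2 = j by omega, ← hκ, abs_le] at h
        have h2 : (0 : ℚ) < 2 / 2 ^ j := by positivity
        by_cases hb : b i
        · rw [show s i = 1 by simp [s, hi3, hb]] at h
          exact of_lt (by linarith [h.1]) (Or.inr (Or.inr (Or.inr ⟨hi3, hpar, hb⟩)))
        · rw [show s i = -1 by simp [s, hi3, hb], neg_div] at h
          refine of_gt (by linarith [h.2]) ?_
          unfold ZigzagUp
          grind
      · rcases Nat.mod_two_eq_zero_or_one i with hp | hp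
        · refine of_gt ?_ ?_
          · linarith [κ_high i hi3 hp, κ_low j hj3 (by omega), hi.1, hj.2]
          · unfold ZigzagUp
            omega
        · refine of_lt ?_ (Or.inr (Or.inr (Or.inl ⟨hi3, hpar, hp⟩)))
          linarith [κ_low i hi3 hp, κ_high j hj3 (by omega), hi.2, hj.1]
  have hinj : Function.Injective fun i : Fin n => κ i := by
    intro i j h
    by_contra hne
    rcases lt_or_gt_of_ne hne with hlt | hlt
    · exact (hup i j hlt).2 h
    · exact (hup j i hlt).2 h.symm
  obtain ⟨π, hπ⟩ := exists_perm_lt_iff _ hinj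
  exact ⟨π, fun i j hij => (hπ i j).trans (hup i j hij).1⟩

/-- The zigzag pattern of length `n` in which the letter `i ≥ 3` is below all later letters of the
same parity if `b i`, and above them otherwise. -/
noncomputable def zigzag (n : ℕ) (b : ℕ → Prop) : Equiv.Perm (Fin n) := (exists_zigzag n b).choose

variable {n : ℕ} {b b' : ℕ → Prop}

theorem zigzag_lt_iff {i j : Fin n} (h : i < j) :
    zigzag n b i < zigzag n b j ↔ ZigzagUp b i j :=
  (exists_zigzag n b).choose_spec i j h

theorem zigzag_gt_iff {i j : Fin n} (h : i < j) :
    zigzag n b j < zigzag n b i ↔ ¬ ZigzagUp b i j := by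
  rw [← zigzag_lt_iff h, not_lt, le_iff_lt_or_eq]
  simp [h.ne']

theorem isZigzag_zigzag : IsZigzag (zigzag n b) := by
  constructor <;> intro i j hi hj
  · exact (zigzag_lt_iff (Fin.lt_def.2 (by omega))).2 (Or.inl (by omega))
  · exact (zigzag_lt_iff (Fin.lt_def.2 (by omega))).2 (Or.inl (by omega))
  · intro hpar
    refine (zigzag_gt_iff (Fin.lt_def.2 (by omega))).2 ?_
    unfold ZigzagUp
    omega
  · intro hpar
    exact (zigzag_lt_iff (Fin.lt_def.2 (by omega))).2 (Or.inr (Or.inl ⟨hi, hpar⟩))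

theorem isFlip_zigzag {t : ℕ} (ht : 3 ≤ t) (h₁ : ∀ i, t ≤ i → i % 2 = t % 2 → (b' i ↔ ¬ b i))
    (h₂ : ∀ i, ¬ (t ≤ i ∧ i % 2 = t % 2) → (b' i ↔ b i)) :
    IsFlip t (zigzag n b) (zigzag n b') := by
  have hrev : ∀ i j : Fin n, i < j → InTail t i → InTail t j →
      (ZigzagUp b' i j ↔ ¬ ZigzagUp b i j) := by
    intro i j hij hi hj
    have := h₁ i hi.1 hi.2
    have hi := hi
    unfold InTail at hi hj
    unfold ZigzagUp
    grind
  have hsame : ∀ i j : Fin n, i < j → ¬ (InTail t i ∧ InTail t j) →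
      (ZigzagUp b' i j ↔ ZigzagUp b i j) := by
    intro i j hij h
    have := h₂ i
    unfold InTail at h
    unfold ZigzagUp
    grind
  refine ⟨ht, fun i j hi hj => ?_, fun i j h => ?_, fun i j k hi hj hk => ?_⟩
  · rcases lt_trichotomy i j with hij | rfl | hij
    · rw [zigzag_lt_iff hij, zigzag_gt_iff hij, hrev i j hij hi hj]
    · simp
    · rw [zigzag_gt_iff hij, zigzag_lt_iff hij, hrev j i hij hj hi, not_not]
  · rcases lt_trichotomy i j with hij | rfl | hij
    · rw [zigzag_lt_iff hij, zigzag_lt_iff hij, hsame i j hij h]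
    · simp
    · rw [zigzag_gt_iff hij, zigzag_gt_iff hij, hsame j i hij (fun H => h H.symm)]
  -- The right side does not involve `i`: a letter before `t` compares alike with all later letters
  -- of one parity, and beyond `t` the parity decides.
  · have key : ∀ i : Fin n, InTail t i → (zigzag n b i < zigzag n b k ↔
        if (k : ℕ) < t then ¬ ZigzagUp b k t else t % 2 = 1) := by
      intro i hi
      unfold InTail at hi hk
      rcases lt_trichotomy i k with hik | rfl | hik
      · rw [zigzag_lt_iff hik]
        unfold ZigzagUp
        grind
      · exact absurd hi hk
      · rw [zigzag_gt_iff hik]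
        unfold ZigzagUp
        grind
    rw [key i hi, key j hj]

/-- The flip at `t` toggles the bits at `t, t + 2, …`, and the flip at `t + 2` restores all of them
except the one at `t`. -/
theorem zigzag_insert_equivalent {t : ℕ} (ht : 3 ≤ t) (B : Finset ℕ) (hB : t ∉ B) :
    CForestWilfEquivalent {⟨n, zigzag n (· ∈ insert t B)⟩} {⟨n, zigzag n (· ∈ B)⟩} := by
  let b : ℕ → Prop := fun i => if t + 2 ≤ i ∧ i % 2 = t % 2 then i ∉ B else i ∈ B
  have h1 : IsFlip t (zigzag n (· ∈ insert t B)) (zigzag n b) := by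
    refine isFlip_zigzag ht (fun i hi hpar => ?_) fun i hi => ?_
    · rcases eq_or_ne i t with rfl | hne
      · simp [b, hB]
      · simp [b, show t + 2 ≤ i by omega, hpar, hne]
    · have hne : i ≠ t := by omega
      simp [b, show ¬ (t + 2 ≤ i ∧ i % 2 = t % 2) by omega, hne]
  have h2 : IsFlip (t + 2) (zigzag n b) (zigzag n (· ∈ B)) := by
    refine isFlip_zigzag (by omega) (fun i hi hpar => ?_) fun i hi => ?_
    · simp [b, hi, show i % 2 = t % 2 by omega]
    · simp [b, show ¬ (t + 2 ≤ i ∧ i % 2 = t % 2) by omega]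
  exact fun N => (h1.cForestWilfEquivalent isZigzag_zigzag N).trans
    (h2.cForestWilfEquivalent isZigzag_zigzag N)

theorem zigzag_equivalent (B : Finset ℕ) (hB : ∀ i ∈ B, 3 ≤ i) :
    CForestWilfEquivalent {⟨n, zigzag n (· ∈ B)⟩} {⟨n, zigzag n (· ∈ (∅ : Finset ℕ))⟩} := by
  induction B using Finset.induction_on with
  | empty => exact fun _ => rfl
  | insert t B htB ih =>
    exact fun N => (zigzag_insert_equivalent (hB t (mem_insert_self t B)) B htB N).trans
      (ih (fun i hi => hB i (mem_insert_of_mem hi)) N)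

/-- The bit at `i` is read off by comparing the letters at `i` and `i + 2`; the bound `n - 3` makes
`i + 2` a position. -/
theorem zigzag_injOn :
    Set.InjOn (fun B : Finset ℕ => zigzag n (· ∈ B)) (Icc 3 (n - 3)).powerset := by
  intro B hB B' hB' h
  replace h : zigzag n (· ∈ B) = zigzag n (· ∈ B') := h
  have hB := mem_powerset.1 (mem_coe.1 hB)
  have hB' := mem_powerset.1 (mem_coe.1 hB')
  ext i
  by_cases hi : i ∈ Icc 3 (n - 3)
  · have hi' := mem_Icc.1 hi
    have hlt : (⟨i, by omega⟩ : Fin n) < ⟨i + 2, by omega⟩ := Fin.lt_def.2 (by simp)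
    have e : ∀ B : Finset ℕ, zigzag n (· ∈ B) ⟨i, by omega⟩ < zigzag n (· ∈ B) ⟨i + 2, by omega⟩ ↔
        i ∈ B := by
      intro B
      rw [zigzag_lt_iff hlt]
      simp only [ZigzagUp]
      grind
    rw [← e B, h, e B']
  · exact iff_of_false (fun h => hi (hB h)) (fun h => hi (hB' h))

end Family

/-! ### Counting the class -/

theorem theorem1p6 (n : ℕ) :
    ∃ C ∈ cForestWilfSetoid.classes,
      (2 : ℚ) ^ ((n : ℤ) - 4) ≤ ({π : Equiv.Perm (Fin n) | (⟨n, π⟩ : Pattern) ∈ C}.ncard : ℚ) := by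
  let π₀ : Equiv.Perm (Fin n) := zigzag n (· ∈ (∅ : Finset ℕ))
  let P : Set (Equiv.Perm (Fin n)) := {π | CForestWilfEquivalent {⟨n, π⟩} {⟨n, π₀⟩}}
  refine ⟨_, cForestWilfSetoid.mem_classes ⟨n, π₀⟩, ?_⟩
  change _ ≤ (P.ncard : ℚ)
  -- For `n ≤ 4` the bound is at most 1, and the class contains `π₀`.
  rcases lt_or_ge n 5 with hn | hn
  · have h1 : 0 < P.ncard := (Set.ncard_pos (Set.toFinite P)).2 ⟨π₀, fun _ => rfl⟩
    calc (2 : ℚ) ^ ((n : ℤ) - 4) ≤ 2 ^ (0 : ℤ) :=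
          zpow_le_zpow_right₀ (by norm_num) (by omega)
      _ ≤ (P.ncard : ℚ) := by
          rw [zpow_zero]
          exact_mod_cast h1
  let A : Finset (Equiv.Perm (Fin n)) :=
    (Icc 3 (n - 3)).powerset.image fun B => zigzag n (· ∈ B)
  let A' : Finset (Equiv.Perm (Fin n)) := A.image fun π => π.trans Fin.revPerm
  have hA : A.card = 2 ^ (n - 5) := by
    rw [card_image_of_injOn zigzag_injOn, card_powerset, Nat.card_Icc]
    congr 1
  have hA' : A'.card = 2 ^ (n - 5) := by
    rw [← hA]
    exact card_image_of_injective _ fun π π' h =>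
      Equiv.ext fun i => Fin.rev_injective (DFunLike.congr_fun h i)
  have hlt : ∀ π ∈ A, π ⟨0, by omega⟩ < π ⟨1, by omega⟩ := by
    intro π hπ
    obtain ⟨B, -, rfl⟩ := mem_image.1 hπ
    exact isZigzag_zigzag.zero_lt _ _ rfl (by simp)
  -- Members of `A` begin with an ascent, their complements with a descent.
  have hdisj : Disjoint A A' := by
    refine disjoint_left.2 fun π hπ hπ' => ?_
    obtain ⟨σ, hσ, rfl⟩ := mem_image.1 hπ'
    have h1 := hlt _ hπ
    simp only [Equiv.trans_apply, Fin.revPerm_apply, Fin.rev_lt_rev] at h1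
    exact h1.asymm (hlt σ hσ)
  have hAP : ∀ π ∈ A, π ∈ P := by
    intro π hπ
    obtain ⟨B, hB, rfl⟩ := mem_image.1 hπ
    exact zigzag_equivalent B fun i hi => (mem_Icc.1 (mem_powerset.1 hB hi)).1
  have hsub : ((A ∪ A' : Finset _) : Set (Equiv.Perm (Fin n))) ⊆ P := by
    intro π hπ
    rcases mem_union.1 (mem_coe.1 hπ) with h | h
    · exact hAP π h
    · obtain ⟨σ, hσ, rfl⟩ := mem_image.1 h
      exact fun N => (cForestWilfEquivalent_complement σ N).symm.trans (hAP σ hσ N)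
  have hcard : 2 ^ (n - 4) ≤ P.ncard := by
    calc 2 ^ (n - 4) = (A ∪ A').card := by
          rw [card_union_of_disjoint hdisj, hA, hA', ← two_mul, ← pow_succ']
          congr 1
          omega
      _ = ((A ∪ A' : Finset _) : Set (Equiv.Perm (Fin n))).ncard := (Set.ncard_coe_finset _).symm
      _ ≤ P.ncard := Set.ncard_le_ncard hsub (Set.toFinite P)
  rw [show (n : ℤ) - 4 = ((n - 4 : ℕ) : ℤ) by omega, zpow_natCast]
  exact_mod_cast hcard
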